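/- For $m\ge 0$ and $r>0$ let $rB_m\subset\mathbb{R}^m$ be the closed Euclidean ball of radius $r$ centered at the origin, let $B_m = 1B_m$, and for $m\ge 1$ let $\sigma$ be the uniform probability measure on the unit sphere $\mathbb{S}^{m-1}$. For integers $0\le j\le n$ define the flag coefficient $$\left[{n\atop j}\right] := \binom{n}{j}\frac{\mathrm{vol}_n(B_n)}{\mathrm{vol}_j(B_j)\,\mathrm{vol}_{n-j}(B_{n-j})},$$ and for $1\le j\le n$ and compact convex sets $K,L\subset\mathbb{R}^n$ define the $j$th intrinsic volume metric $$\delta_j(K,L):=\left[{n\atop j}\right]\int_{\mathrm{Gr}(n,j)}\mathrm{vol}_j\big((K|H)\,\triangle\,(L|H)\big)\,d\nu_j(H),$$ where $\mathrm{Gr}(n,j)$ is the Grassmannian of $j$-dimensional linear subspaces of $\mathbb{R}^n$, $\nu_j$ is its Haar (rotation invariant) probability measure, $K|H$ is the orthogonal projection of $K$ into $H$, and $\triangle$ is the symmetric difference. For $\beta>-1$ the beta distribution on $\mathbb{R}^m$, $m\ge 1$, with parameter $\beta$ is the probability measure with density $$f_{m,\beta}(x)=\frac{\Gamma(\frac m2+\beta+1)}{\pi^{m/2}\,\Gamma(\beta+1)}\,(1-\|x\|^2)^\beta\,\mathbf{1}_{\{\|x\|<1\}};$$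 for $\beta=-1$ it is $\sigma$, regarded as a measure on $\mathbb{R}^m$. **Lemma.** Let $n,j,N$ be integers with $1\le j\le n$ and $N\ge 0$, and let $r>0$. Let $U_1,\dots,U_N$ be independent random points uniformly distributed on $\mathbb{S}^{n-1}$, and let $P$ be their convex hull. Let $X_1,\dots,X_N$ be independent random points in $\mathbb{R}^j$ having the beta distribution with parameter $\beta=\frac{n-j-2}{2}$, and let $P'$ be their convex hull. Then the random variables $\delta_j(P,rB_n)$ and $\mathrm{vol}_j(P'\triangle rB_j)$ are integrable, and $$\mathbb{E}\big[\delta_j(P,rB_n)\big]=\left[{n\atop j}\right]\,\mathbb{E}\big[\mathrm{vol}_j(P'\triangle rB_j)\big].$$ (For $N=0$ the convex hulls are empty.) -/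

import Mathlib

open MeasureTheory ProbabilityTheory

/-- Euclidean space `ℝⁿ`. -/
abbrev RSpace (n : ℕ) : Type := EuclideanSpace ℝ (Fin n)

/-- The closed ball `r Bₙ` of radius `r` around the origin of `ℝⁿ`. -/
abbrev originBall (n : ℕ) (r : ℝ) : Set (RSpace n) := Metric.closedBall 0 r

/-- The unit sphere `Sⁿ⁻¹` of `ℝⁿ`. -/
abbrev USphere (n : ℕ) : Type := Metric.sphere (0 : RSpace n) 1

/-- The uniform probability measure `σ` on `Sⁿ⁻¹` (for `n ≥ 1`): normalized surface measure. -/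
noncomputable def sphereUniform (n : ℕ) : Measure (USphere n) :=
  ((volume : Measure (RSpace n)).toSphere Set.univ)⁻¹ • (volume : Measure (RSpace n)).toSphere

/-- The normalization constant `Γ(n/2 + β + 1) / (π^{n/2} Γ(β + 1))` of the beta density. -/
noncomputable def betaConst (n : ℕ) (β : ℝ) : ℝ :=
  Real.Gamma ((n : ℝ) / 2 + β + 1) / (Real.pi ^ ((n : ℝ) / 2) * Real.Gamma (β + 1))

/-- The beta density `c_{n,β} (1 - ‖x‖²)^β` on the open unit ball of `ℝⁿ`, zero elsewhere. -/
noncomputable def betaPDF (n : ℕ) (β : ℝ) (x : RSpace n) : ℝ :=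
  if ‖x‖ < 1 then betaConst n β * (1 - ‖x‖ ^ 2) ^ β else 0

/-- The beta distribution on `ℝⁿ` with parameter `β ≥ -1`. For `β > -1` it has the density
`betaPDF n β`; for `β = -1` it is, by the usual convention, the weak limit as `β → -1⁺`, that is,
the uniform distribution on the unit sphere. -/
noncomputable def betaDistribution (n : ℕ) (β : ℝ) : Measure (RSpace n) :=
  if β = -1 then (sphereUniform n).map (fun u : USphere n => (u : RSpace n))
  else volume.withDensity (fun x => ENNReal.ofReal (betaPDF n β x))

/-- The flag coefficient `binom(n,j) vol_n(B_n) / (vol_j(B_j) vol_{n-j}(B_{n-j}))`, `j ≤ n`. -/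
noncomputable def flagCoeff (n j : ℕ) : ℝ :=
  (n.choose j : ℝ) * volume.real (originBall n 1) /
    (volume.real (originBall j 1) * volume.real (originBall (n - j) 1))

/-- The orthogonal group `O(n)`, as the group of linear isometries of `ℝⁿ`
(continuous linear maps `u` with `u* u = u u* = 1`), with the operator norm topology. -/
abbrev OGroup (n : ℕ) : Type := unitary (RSpace n →L[ℝ] RSpace n)

instance continuousStar_euclideanEnd (n : ℕ) : ContinuousStar (RSpace n →L[ℝ] RSpace n) :=
  ⟨(ContinuousLinearMap.adjoint (𝕜 := ℝ) (E := RSpace n) (F := RSpace n)).continuous⟩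

instance OGroup.compactSpace (n : ℕ) : CompactSpace (OGroup n) := by
  have h : IsClosed (unitary (RSpace n →L[ℝ] RSpace n) : Set (RSpace n →L[ℝ] RSpace n)) :=
    isClosed_unitary
  refine isCompact_iff_compactSpace.mp (Metric.isCompact_of_isClosed_isBounded h ?_)
  refine (Metric.isBounded_closedBall (x := 0) (r := 1)).subset fun u hu => ?_
  rw [mem_closedBall_zero_iff]
  refine ContinuousLinearMap.opNorm_le_bound _ zero_le_one fun x => ?_
  rw [one_mul]
  exact (Unitary.norm_map (⟨u, hu⟩ : unitary (RSpace n →L[ℝ] RSpace n)) x).le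

/-- The Haar probability measure on `O(n)`. -/
noncomputable def orthogonalHaar (n : ℕ) : Measure (OGroup n) :=
  Measure.haarMeasure ⊤

instance orthogonalHaar.isProbabilityMeasure (n : ℕ) : IsProbabilityMeasure (orthogonalHaar n) :=
  ⟨by have := Measure.haarMeasure_self (G := OGroup n) (K₀ := ⊤); simpa [orthogonalHaar] using this⟩

/-- The Grassmannian `Gr(n,j)` of all `j`-dimensional linear subspaces of `ℝⁿ`. -/
def Gr (n j : ℕ) : Type := {H : Submodule ℝ (RSpace n) // Module.finrank ℝ H = j}

/-- The usual topology of `Gr(n,j)`: subspaces are close if the orthogonal projections onto them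
are close in the operator norm. -/
noncomputable instance Gr.topologicalSpace (n j : ℕ) : TopologicalSpace (Gr n j) :=
  TopologicalSpace.induced (fun H => H.1.starProjection) inferInstance

noncomputable instance Gr.measurableSpace (n j : ℕ) : MeasurableSpace (Gr n j) := borel _

instance Gr.borelSpace (n j : ℕ) : BorelSpace (Gr n j) := ⟨rfl⟩

/-- The action of `O(n)` on `Gr(n,j)`, `(u, H) ↦ u(H)`. -/
noncomputable def Gr.rotate {n j : ℕ} (u : OGroup n) (H : Gr n j) : Gr n j :=
  ⟨H.1.map (u : RSpace n →L[ℝ] RSpace n).toLinearMap,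
    (LinearEquiv.finrank_map_eq (Unitary.linearIsometryEquiv u).toLinearEquiv H.1).trans H.2⟩

theorem Gr.continuous_rotate {n j : ℕ} (H : Gr n j) :
    Continuous (fun u : OGroup n => Gr.rotate u H) := by
  refine continuous_induced_rng.2 ?_
  have : (fun u : OGroup n => (Gr.rotate u H).1.starProjection) = fun u : OGroup n =>
      (u : RSpace n →L[ℝ] RSpace n) * H.1.starProjection * (star (u : RSpace n →L[ℝ] RSpace n)) := by
    funext u
    ext1 x
    have := Submodule.starProjection_map_apply (Unitary.linearIsometryEquiv u) H.1 x
    exact this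
  change Continuous (fun u : OGroup n => (Gr.rotate u H).1.starProjection)
  rw [this]
  fun_prop

/-- The coordinate subspace of `ℝⁿ` spanned by the first `j` standard basis vectors. -/
noncomputable def Gr.coord {n j : ℕ} (hjn : j ≤ n) : Gr n j :=
  ⟨Submodule.span ℝ (Set.range fun i : Fin j => EuclideanSpace.single (Fin.castLE hjn i) (1 : ℝ)),
    by
      have h := (EuclideanSpace.orthonormal_single (𝕜 := ℝ) (ι := Fin n)).linearIndependent.comp
        (Fin.castLE hjn) (Fin.castLE_injective hjn)
      exact (finrank_span_eq_card h).trans (Fintype.card_fin j)⟩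

/-- The Haar probability measure `ν_j` on `Gr(n,j)`: the distribution of `u(H₀)` where `u` is
Haar distributed on `O(n)` and `H₀` is a fixed `j`-dimensional subspace. -/
noncomputable def grassmannianHaar {n j : ℕ} (hjn : j ≤ n) : Measure (Gr n j) :=
  (orthogonalHaar n).map (fun u => Gr.rotate u (Gr.coord hjn))

instance grassmannianHaar.isProbabilityMeasure {n j : ℕ} (hjn : j ≤ n) : IsProbabilityMeasure (grassmannianHaar hjn) :=
  Measure.isProbabilityMeasure_map (Gr.continuous_rotate _).measurable.aemeasurable

/-- The orthogonal projection `K|H` of `K ⊆ ℝⁿ` into the subspace `H`, as a subset of `H`. -/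
def shadow {n j : ℕ} (K : Set (RSpace n)) (H : Gr n j) : Set H.1 :=
  H.1.orthogonalProjectionOnto '' K

/-- The `j`th intrinsic volume metric `δ_j(K, L)`; `volume` is the `j`-dimensional Lebesgue measure
of the subspace `H` with the inner product inherited from `ℝⁿ`. -/
noncomputable def intrinsicVolumeMetric {n j : ℕ} (hjn : j ≤ n) (K L : Set (RSpace n)) : ℝ :=
  flagCoeff n j *
    ∫ H : Gr n j, volume.real (symmDiff (shadow K H) (shadow L H)) ∂(grassmannianHaar hjn)

/-! A random `j`-dimensional subspace is `u(H₀)` with `u` Haar distributed on `O(n)` and `H₀` the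
coordinate subspace. Identified isometrically with `ℝʲ`, its orthogonal projection becomes `x ↦ π(u*
x)`, where `π` keeps the first `j` coordinates. Linear maps commute with convex hulls, and the
shadow of `r Bₙ` is `r Bⱼ`. Hence the integrand of `δ_j` is `hullBallVolume r` of the projected
points (`volume_real_symmDiff_shadow_rotate`).

For each fixed `u`, the points `π(u* Uᵢ)` are i.i.d., and by rotation invariance of `σ` their law
does not depend on `u`. It is the beta law with parameter `(n - j - 2) / 2`
(`map_coordProj_sphereUniform`, `map_rotatedProj`). All volumes involved are bounded, so Fubini
exchanges the expectation with the average over `O(n)`, whose integrand is then constant in `u`.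

The beta marginal comes from integrating a radial cut-off times a function of `π(x / ‖x‖)` over `ℝʲ
× ℝᵏ`, `n = j + k`, in two ways: in polar coordinates of `ℝʲ⁺ᵏ`, and in polar coordinates of each
factor (`lintegral_toSphere_coordProj`). -/

/-! ### Polar coordinates and radial substitutions -/

theorem lintegral_volumeIoiPow (n : ℕ) {f : ℝ → ENNReal} (hf : Measurable f) :
    ∫⁻ t : Set.Ioi (0 : ℝ), f t ∂(Measure.volumeIoiPow n) =
      ∫⁻ t in Set.Ioi (0 : ℝ), ENNReal.ofReal (t ^ n) * f t := by
  rw [Measure.volumeIoiPow, lintegral_withDensity_eq_lintegral_mul _ (by fun_prop) (by fun_prop)]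
  exact lintegral_subtype_comap measurableSet_Ioi fun t : ℝ => ENNReal.ofReal (t ^ n) * f t

/-- Integration in polar coordinates. -/
theorem lintegral_eq_lintegral_toSphere {E : Type*} [NormedAddCommGroup E] [NormedSpace ℝ E]
    [MeasurableSpace E] [BorelSpace E] [FiniteDimensional ℝ E] [Nontrivial E]
    (μ : Measure E) [μ.IsAddHaarMeasure] {f : E → ENNReal} (hf : Measurable f) :
    ∫⁻ x, f x ∂μ = ∫⁻ θ : Metric.sphere (0 : E) 1, (∫⁻ t in Set.Ioi (0 : ℝ),
      ENNReal.ofReal (t ^ (Module.finrank ℝ E - 1)) * f (t • (θ : E))) ∂μ.toSphere := by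
  have hs : Measurable fun p : Metric.sphere (0 : E) 1 × Set.Ioi (0 : ℝ) =>
      f ((p.2 : ℝ) • (p.1 : E)) := hf.comp (by fun_prop)
  calc ∫⁻ x, f x ∂μ = ∫⁻ x : ({0}ᶜ : Set E), f x ∂(μ.comap (↑)) := by
        rw [lintegral_subtype_comap (measurableSet_singleton _).compl,
          restrict_compl_singleton]
    _ = ∫⁻ p, f ((p.2 : ℝ) • (p.1 : E))
          ∂(μ.toSphere.prod (.volumeIoiPow (Module.finrank ℝ E - 1))) := by
        rw [← μ.measurePreserving_homeomorphUnitSphereProd.lintegral_comp hs]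
        refine lintegral_congr fun x => ?_
        congr 1
        have hx : ‖(x : E)‖ ≠ 0 := norm_ne_zero_iff.2 x.2
        simp [smul_smul, hx]
    _ = _ := by
        rw [lintegral_prod _ hs.aemeasurable]
        refine lintegral_congr fun θ => ?_
        exact lintegral_volumeIoiPow _ (f := fun t : ℝ => f (t • (θ : E))) (hf.comp (by fun_prop))

theorem lintegral_Ioi_comp_mul_left {c : ℝ} (hc : 0 < c) (f : ℝ → ENNReal) :
    ∫⁻ s in Set.Ioi (0 : ℝ), f s = ∫⁻ s in Set.Ioi (0 : ℝ), ENNReal.ofReal c * f (c * s) := by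
  have him : (fun s => c * s) '' Set.Ioi (0 : ℝ) = Set.Ioi 0 := by
    simp [Set.image_mul_left_Ioi hc]
  have := lintegral_image_eq_lintegral_abs_deriv_mul (s := Set.Ioi (0 : ℝ)) (f := fun s => c * s)
    (f' := fun _ => c) measurableSet_Ioi
    (fun x _ => by simpa using ((hasDerivAt_id x).const_mul c).hasDerivWithinAt)
    ((mul_right_injective₀ hc.ne').injOn) f
  rw [him, abs_of_pos hc] at this
  exact this

/-- The substitution `t = s τ / √(1 - τ²)`. -/
theorem lintegral_Ioi_eq_lintegral_Ioo_div_sqrt {s : ℝ} (hs : 0 < s) (f : ℝ → ENNReal) :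
    ∫⁻ t in Set.Ioi (0 : ℝ), f t = ∫⁻ τ in Set.Ioo (0 : ℝ) 1,
      ENNReal.ofReal (s / √(1 - τ ^ 2) ^ 3) * f (s * τ / √(1 - τ ^ 2)) := by
  have hpos : ∀ τ ∈ Set.Ioo (0 : ℝ) 1, 0 < 1 - τ ^ 2 := fun τ hτ => by nlinarith [hτ.1, hτ.2]
  have key : ∀ τ ∈ Set.Ioo (0 : ℝ) 1,
      (s * τ / √(1 - τ ^ 2)) ^ 2 + s ^ 2 = s ^ 2 / (1 - τ ^ 2) := fun τ hτ => by
    have := hpos τ hτ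
    rw [div_pow, Real.sq_sqrt this.le]
    field_simp
    ring
  have him : (fun τ => s * τ / √(1 - τ ^ 2)) '' Set.Ioo (0 : ℝ) 1 = Set.Ioi 0 := by
    apply Set.Subset.antisymm
    · rintro _ ⟨τ, hτ, rfl⟩
      have := Real.sqrt_pos.2 (hpos τ hτ)
      have := hτ.1
      simp only [Set.mem_Ioi]
      positivity
    · intro t (ht : 0 < t)
      have hq : 0 < s ^ 2 + t ^ 2 := by positivity
      have hq' : 0 < √(s ^ 2 + t ^ 2) := Real.sqrt_pos.2 hq
      -- The inverse substitution: `τ` is the cosine of the angle between `(t, s)` and the `t`-axis.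
      refine ⟨t / √(s ^ 2 + t ^ 2), ⟨by positivity, ?_⟩, ?_⟩
      · rw [div_lt_one hq']
        exact Real.lt_sqrt_of_sq_lt (by nlinarith)
      · have : 1 - (t / √(s ^ 2 + t ^ 2)) ^ 2 = (s / √(s ^ 2 + t ^ 2)) ^ 2 := by
          rw [div_pow, div_pow, Real.sq_sqrt hq.le]
          field_simp
          ring
        simp only [this]
        rw [Real.sqrt_sq (by positivity)]
        field_simp
  have hinj : Set.InjOn (fun τ => s * τ / √(1 - τ ^ 2)) (Set.Ioo (0 : ℝ) 1) := by
    intro a ha b hb hab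
    have h1 := key a ha
    simp only at hab
    rw [hab, key b hb, div_eq_div_iff (hpos b hb).ne' (hpos a ha).ne'] at h1
    have h2 : a ^ 2 = b ^ 2 := by
      have := mul_left_cancel₀ (pow_ne_zero 2 hs.ne') h1
      linarith
    exact (pow_left_inj₀ ha.1.le hb.1.le two_ne_zero).1 h2
  have hderiv : ∀ τ ∈ Set.Ioo (0 : ℝ) 1, HasDerivWithinAt (fun τ => s * τ / √(1 - τ ^ 2))
      (s / √(1 - τ ^ 2) ^ 3) (Set.Ioo 0 1) τ := by
    intro τ hτ
    have h0 := hpos τ hτ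
    have h1 := Real.sqrt_pos.2 h0
    have hd : HasDerivAt (fun τ : ℝ => √(1 - τ ^ 2)) ((-(2 * τ)) / (2 * √(1 - τ ^ 2))) τ := by
      refine HasDerivAt.sqrt ?_ h0.ne'
      simpa using ((hasDerivAt_id τ).pow 2).const_sub 1
    have hd2 := ((hasDerivAt_id τ).const_mul s).div hd h1.ne'
    refine (hd2.congr_deriv ?_).hasDerivWithinAt
    have h3 : √(1 - τ ^ 2) ^ 2 = 1 - τ ^ 2 := Real.sq_sqrt h0.le
    simp only [id, mul_one]
    field_simp
    linear_combination h3
  have := lintegral_image_eq_lintegral_abs_deriv_mul measurableSet_Ioo hderiv hinj f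
  rw [him] at this
  rw [this]
  refine setLIntegral_congr_fun measurableSet_Ioo fun τ hτ => ?_
  have := Real.sqrt_pos.2 (hpos τ hτ)
  rw [abs_of_pos (by positivity)]

/-- Polar coordinates in the quadrant, with `ρ = √(t² + s²)` and `τ = t / ρ` in place of the angle:
`dt ds = ρ (1 - τ²)^(-1/2) dρ dτ`. Together with `s^(k-1) = ρ^(k-1) (1 - τ²)^((k-1)/2)` this
produces the beta exponent `(k - 2) / 2`. The change of variables is done one variable at a time:
`t` to `τ` for fixed `s`, then `s = √(1 - τ²) ρ` for fixed `τ`. -/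
theorem lintegral_Ioi_Ioi_radial {j k : ℕ} (hj : 1 ≤ j) (hk : 1 ≤ k) {F h : ℝ → ENNReal}
    (hF : Measurable F) (hh : Measurable h) :
    ∫⁻ t in Set.Ioi (0 : ℝ), ∫⁻ s in Set.Ioi (0 : ℝ),
      ENNReal.ofReal (t ^ (j - 1)) * (ENNReal.ofReal (s ^ (k - 1)) *
        (F √(t ^ 2 + s ^ 2) * h (t / √(t ^ 2 + s ^ 2)))) =
    (∫⁻ ρ in Set.Ioi (0 : ℝ), ENNReal.ofReal (ρ ^ (j + k - 1)) * F ρ) *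
      ∫⁻ τ in Set.Ioo (0 : ℝ) 1,
        ENNReal.ofReal (τ ^ (j - 1)) * (ENNReal.ofReal ((1 - τ ^ 2) ^ (((k : ℝ) - 2) / 2)) * h τ) := by
  have hpos : ∀ τ ∈ Set.Ioo (0 : ℝ) 1, 0 < 1 - τ ^ 2 := fun τ hτ => by nlinarith [hτ.1, hτ.2]
  rw [lintegral_lintegral_swap (by fun_prop)]
  calc _ = ∫⁻ s in Set.Ioi (0 : ℝ), ∫⁻ τ in Set.Ioo (0 : ℝ) 1,
        ENNReal.ofReal (s / √(1 - τ ^ 2) ^ 3) *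
        (ENNReal.ofReal ((s * τ / √(1 - τ ^ 2)) ^ (j - 1)) * (ENNReal.ofReal (s ^ (k - 1)) *
        (F (s / √(1 - τ ^ 2)) * h τ))) := by
        refine setLIntegral_congr_fun measurableSet_Ioi fun s hs => ?_
        rw [lintegral_Ioi_eq_lintegral_Ioo_div_sqrt hs]
        refine setLIntegral_congr_fun measurableSet_Ioo fun τ hτ => ?_
        have hs' : 0 < s := hs
        have h0 := hpos τ hτ
        have h1 := Real.sqrt_pos.2 h0
        have h2 : (s * τ / √(1 - τ ^ 2)) ^ 2 + s ^ 2 = (s / √(1 - τ ^ 2)) ^ 2 := by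
          rw [div_pow, div_pow, Real.sq_sqrt h0.le]
          field_simp
          ring
        simp only [h2]
        rw [Real.sqrt_sq (by positivity)]
        congr 5
        field_simp
    _ = ∫⁻ τ in Set.Ioo (0 : ℝ) 1, ∫⁻ s in Set.Ioi (0 : ℝ),
        ENNReal.ofReal (s / √(1 - τ ^ 2) ^ 3) *
        (ENNReal.ofReal ((s * τ / √(1 - τ ^ 2)) ^ (j - 1)) * (ENNReal.ofReal (s ^ (k - 1)) *
        (F (s / √(1 - τ ^ 2)) * h τ))) := lintegral_lintegral_swap (by fun_prop)
    _ = ∫⁻ τ in Set.Ioo (0 : ℝ) 1,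
        (∫⁻ ρ in Set.Ioi (0 : ℝ), ENNReal.ofReal (ρ ^ (j + k - 1)) * F ρ) *
        (ENNReal.ofReal (τ ^ (j - 1)) *
          (ENNReal.ofReal ((1 - τ ^ 2) ^ (((k : ℝ) - 2) / 2)) * h τ)) := by
        refine setLIntegral_congr_fun measurableSet_Ioo fun τ hτ => ?_
        have h0 := hpos τ hτ
        have h1 := Real.sqrt_pos.2 h0
        have hτ0 : 0 < τ := hτ.1
        rw [lintegral_Ioi_comp_mul_left h1, ← lintegral_mul_const _ (by fun_prop)]
        refine setLIntegral_congr_fun measurableSet_Ioi fun ρ hρ => ?_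
        have hρ0 : 0 < ρ := hρ
        have e1 : √(1 - τ ^ 2) * ρ / √(1 - τ ^ 2) = ρ := by field_simp
        have e2 : √(1 - τ ^ 2) * ρ * τ / √(1 - τ ^ 2) = ρ * τ := by field_simp
        simp only [e1, e2]
        have e3 : (1 - τ ^ 2) ^ (((k : ℝ) - 2) / 2) = √(1 - τ ^ 2) ^ k / √(1 - τ ^ 2) ^ 2 := by
          rw [Real.sqrt_eq_rpow, ← Real.rpow_mul_natCast h0.le, ← Real.rpow_mul_natCast h0.le,
            ← Real.rpow_sub h0]
          congr 1
          push_cast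
          ring
        have e4 : ENNReal.ofReal √(1 - τ ^ 2) *
            (ENNReal.ofReal (√(1 - τ ^ 2) * ρ / √(1 - τ ^ 2) ^ 3) *
              (ENNReal.ofReal ((ρ * τ) ^ (j - 1)) *
                ENNReal.ofReal ((√(1 - τ ^ 2) * ρ) ^ (k - 1)))) =
            ENNReal.ofReal (ρ ^ (j + k - 1)) * (ENNReal.ofReal (τ ^ (j - 1)) *
              ENNReal.ofReal ((1 - τ ^ 2) ^ (((k : ℝ) - 2) / 2))) := by
          rw [← ENNReal.ofReal_mul (by positivity), ← ENNReal.ofReal_mul (by positivity),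
            ← ENNReal.ofReal_mul (by positivity), ← ENNReal.ofReal_mul (by positivity),
            ← ENNReal.ofReal_mul (by positivity), e3]
          congr 1
          -- Writing `j = a + 1` and `k = b + 1` removes the truncated subtractions from the
          -- exponents.
          obtain ⟨a, rfl⟩ := Nat.exists_eq_add_of_le' hj
          obtain ⟨b, rfl⟩ := Nat.exists_eq_add_of_le' hk
          have : a + 1 + (b + 1) - 1 = a + b + 1 := by omega
          simp only [this, Nat.add_sub_cancel]
          field_simp
          ring
        calc _ = ENNReal.ofReal √(1 - τ ^ 2) *
            (ENNReal.ofReal (√(1 - τ ^ 2) * ρ / √(1 - τ ^ 2) ^ 3) *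
              (ENNReal.ofReal ((ρ * τ) ^ (j - 1)) *
                ENNReal.ofReal ((√(1 - τ ^ 2) * ρ) ^ (k - 1)))) * (F ρ * h τ) := by ring
          _ = _ := by rw [e4]; ring
    _ = _ := lintegral_const_mul _ (by fun_prop)

/-! ### Coordinate subspaces and the splitting of Euclidean space -/

/-- The inclusion of `ℝʲ` into `ℝⁿ` as the first `j` coordinates. -/
noncomputable def coordIncl {n j : ℕ} (hjn : j ≤ n) : RSpace j →ₗᵢ[ℝ] RSpace n :=
  ((EuclideanSpace.basisFun (Fin j) ℝ).toBasis.constr ℝ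
    fun i => EuclideanSpace.single (Fin.castLE hjn i) (1 : ℝ)).isometryOfOrthonormal
    (v := (EuclideanSpace.basisFun (Fin j) ℝ).toBasis)
    (by simp)
    (by
      have := (EuclideanSpace.orthonormal_single (𝕜 := ℝ) (ι := Fin n)).comp
        (Fin.castLE hjn) (Fin.castLE_injective hjn)
      convert this using 1
      ext1 i
      simp)

theorem coordIncl_single {n j : ℕ} (hjn : j ≤ n) (i : Fin j) :
    coordIncl hjn (EuclideanSpace.single i 1) = EuclideanSpace.single (Fin.castLE hjn i) (1 : ℝ) := by
  have := (EuclideanSpace.basisFun (Fin j) ℝ).toBasis.constr_basis ℝ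
    (fun i => EuclideanSpace.single (Fin.castLE hjn i) (1 : ℝ)) i
  rw [OrthonormalBasis.coe_toBasis, EuclideanSpace.basisFun_apply] at this
  exact this

theorem range_coordIncl {n j : ℕ} (hjn : j ≤ n) :
    LinearMap.range (coordIncl hjn).toLinearMap = (Gr.coord hjn).1 :=
  (EuclideanSpace.basisFun (Fin j) ℝ).toBasis.constr_range ℝ

/-- The projection of `ℝⁿ` onto the first `j` coordinates. -/
noncomputable def coordProj {n j : ℕ} (hjn : j ≤ n) : RSpace n →L[ℝ] RSpace j :=
  ContinuousLinearMap.adjoint (coordIncl hjn).toContinuousLinearMap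

theorem coordProj_apply {n j : ℕ} (hjn : j ≤ n) (x : RSpace n) (i : Fin j) :
    coordProj hjn x i = x (Fin.castLE hjn i) := by
  have := ContinuousLinearMap.adjoint_inner_left (coordIncl hjn).toContinuousLinearMap
    (EuclideanSpace.single i 1) x
  rw [LinearIsometry.coe_toContinuousLinearMap, coordIncl_single] at this
  simp only [EuclideanSpace.inner_single_right, conj_trivial, one_mul] at this
  exact this

/-- The isometric splitting `ℝʲ⁺ᵏ ≃ ℝʲ × ℝᵏ`. -/
noncomputable def coordSplit (j k : ℕ) : RSpace (j + k) ≃ₗᵢ[ℝ] WithLp 2 (RSpace j × RSpace k) :=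
  (LinearIsometryEquiv.piLpCongrLeft 2 ℝ ℝ finSumFinEquiv.symm).trans
    (PiLp.sumPiLpEquivProdLpPiLp 2 fun _ => ℝ)

theorem coordSplit_fst (j k : ℕ) (x : RSpace (j + k)) :
    (coordSplit j k x).fst = coordProj (Nat.le_add_right j k) x := by
  ext i
  rw [coordProj_apply]
  simp [coordSplit, PiLp.sumPiLpEquivProdLpPiLp]
  rfl

theorem measurePreserving_coordSplit (j k : ℕ) :
    MeasurePreserving (fun x => WithLp.ofLp (coordSplit j k x))
      (volume : Measure (RSpace (j + k))) ((volume : Measure (RSpace j)).prod volume) :=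
  (WithLp.volume_preserving_ofLp (RSpace j) (RSpace k)).comp (coordSplit j k).measurePreserving

/-- Tonelli for the isometric splitting, using `‖x‖² = ‖y‖² + ‖z‖²`. -/
theorem lintegral_norm_coordProj (j k : ℕ) {G : ℝ → RSpace j → ENNReal}
    (hG : Measurable (Function.uncurry G)) :
    ∫⁻ x : RSpace (j + k), G ‖x‖ (coordProj (Nat.le_add_right j k) x) =
      ∫⁻ y : RSpace j, ∫⁻ z : RSpace k, G √(‖y‖ ^ 2 + ‖z‖ ^ 2) y := by
  have hm : Measurable fun p : RSpace j × RSpace k => G √(‖p.1‖ ^ 2 + ‖p.2‖ ^ 2) p.1 :=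
    hG.comp (f := fun p : RSpace j × RSpace k => (√(‖p.1‖ ^ 2 + ‖p.2‖ ^ 2), p.1)) (by fun_prop)
  rw [← lintegral_prod (fun p : RSpace j × RSpace k => G √(‖p.1‖ ^ 2 + ‖p.2‖ ^ 2) p.1)
    hm.aemeasurable, ← (measurePreserving_coordSplit j k).lintegral_comp hm]
  refine lintegral_congr fun x => ?_
  have h := WithLp.prod_norm_eq_of_L2 (coordSplit j k x)
  rw [LinearIsometryEquiv.norm_map] at h
  rw [h, ← coordSplit_fst]
  rfl

/-! ### Surface measure of the sphere through Lebesgue measure -/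

theorem nontrivial_rSpace {n : ℕ} (hn : 1 ≤ n) : Nontrivial (RSpace n) :=
  Module.nontrivial_of_finrank_pos (R := ℝ) 
    (by simpa using Nat.pos_of_ne_zero (Nat.one_le_iff_ne_zero.1 hn))

/-- The radial factor belonging to the cut-off `‖x‖ < 1`; being neither `0` nor `∞`, it can be
cancelled in the comparisons below. -/
theorem lintegral_pow_mul_indicator_Iio_one (n : ℕ) :
    ∫⁻ ρ in Set.Ioi (0 : ℝ), ENNReal.ofReal (ρ ^ n) * (Set.Iio 1).indicator 1 ρ =
      ENNReal.ofReal (1 / (n + 1)) := by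
  have h := Measure.volumeIoiPow_apply_Iio n ⟨1, Set.mem_Ioi.2 one_pos⟩
  rw [← lintegral_indicator_one measurableSet_Iio] at h
  simp only [one_pow] at h
  rw [← h, ← lintegral_volumeIoiPow _ (measurable_one.indicator measurableSet_Iio)]
  rfl

/-- In polar coordinates a radial function times a function of the direction factorizes. Identities
for Lebesgue measure thereby pass to the surface measure. -/
theorem lintegral_norm_mul_normalize {E : Type*} [NormedAddCommGroup E] [NormedSpace ℝ E]
    [MeasurableSpace E] [BorelSpace E] [FiniteDimensional ℝ E] [Nontrivial E]
    (μ : Measure E) [μ.IsAddHaarMeasure] {F : ℝ → ENNReal} (hF : Measurable F)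
    {f : E → ENNReal} (hf : Measurable f) :
    ∫⁻ x, F ‖x‖ * f (‖x‖⁻¹ • x) ∂μ =
      (∫⁻ ρ in Set.Ioi (0 : ℝ), ENNReal.ofReal (ρ ^ (Module.finrank ℝ E - 1)) * F ρ) *
        ∫⁻ θ : Metric.sphere (0 : E) 1, f θ ∂μ.toSphere := by
  have hm : Measurable fun x : E => F ‖x‖ * f (‖x‖⁻¹ • x) :=
    (hF.comp measurable_norm).mul (hf.comp (by fun_prop))
  rw [lintegral_eq_lintegral_toSphere _ hm, ← lintegral_const_mul _ (by fun_prop)]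
  refine lintegral_congr fun θ => ?_
  rw [← lintegral_mul_const _ (by fun_prop)]
  refine setLIntegral_congr_fun measurableSet_Ioi fun t ht => ?_
  have ht0 : 0 < t := ht
  have hθ : ‖(θ : E)‖ = 1 := norm_eq_of_mem_sphere θ
  simp only [norm_smul, hθ, mul_one, Real.norm_of_nonneg ht0.le, smul_smul,
    inv_mul_cancel₀ ht0.ne', one_smul, mul_assoc]

/-- Linear isometries preserve Lebesgue measure and norms, so multiplying both sides by the radial
factor of the unit ball reduces invariance on the sphere to invariance on `E`. -/
theorem lintegral_toSphere_comp_linearIsometryEquiv {E : Type*} [NormedAddCommGroup E]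
    [InnerProductSpace ℝ E] [MeasurableSpace E] [BorelSpace E] [FiniteDimensional ℝ E]
    [Nontrivial E] (e : E ≃ₗᵢ[ℝ] E) {f : E → ENNReal} (hf : Measurable f) :
    ∫⁻ θ : Metric.sphere (0 : E) 1, f (e θ) ∂(volume : Measure E).toSphere =
      ∫⁻ θ : Metric.sphere (0 : E) 1, f θ ∂(volume : Measure E).toSphere := by
  have hF : Measurable ((Set.Iio (1 : ℝ)).indicator (1 : ℝ → ENNReal)) :=
    measurable_one.indicator measurableSet_Iio
  have h0 : ∫⁻ ρ in Set.Ioi (0 : ℝ), ENNReal.ofReal (ρ ^ (Module.finrank ℝ E - 1)) *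
      (Set.Iio 1).indicator 1 ρ ≠ 0 := by
    rw [lintegral_pow_mul_indicator_Iio_one]
    exact (ENNReal.ofReal_pos.2 (by positivity)).ne'
  have htop : ∫⁻ ρ in Set.Ioi (0 : ℝ), ENNReal.ofReal (ρ ^ (Module.finrank ℝ E - 1)) *
      (Set.Iio 1).indicator 1 ρ ≠ ⊤ := by
    rw [lintegral_pow_mul_indicator_Iio_one]
    exact ENNReal.ofReal_ne_top
  refine (ENNReal.mul_right_inj h0 htop).1 ?_
  have hfe : Measurable fun x => f (e x) := hf.comp e.continuous.measurable
  have hm : Measurable fun x : E => (Set.Iio (1 : ℝ)).indicator (1 : ℝ → ENNReal) ‖x‖ *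
      f (‖x‖⁻¹ • x) := (hF.comp measurable_norm).mul (hf.comp (by fun_prop))
  rw [← lintegral_norm_mul_normalize _ hF hf, ← lintegral_norm_mul_normalize _ hF hfe,
    ← e.measurePreserving.lintegral_comp hm]
  simp only [LinearIsometryEquiv.norm_map, map_smul]

/-- After multiplication by the radial factor `I`, the left side is a Lebesgue integral over `ℝʲ⁺ᵏ`.
Splitting it and using polar coordinates in both factors leaves the quadrant integral of
`lintegral_Ioi_Ioi_radial`, whose `ρ`-part is again `I`. -/
theorem lintegral_toSphere_coordProj {j k : ℕ} (hj : 1 ≤ j) (hk : 1 ≤ k)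
    {f : RSpace j → ENNReal} (hf : Measurable f) :
    ∫⁻ θ : USphere (j + k), f (coordProj (Nat.le_add_right j k) θ)
        ∂(volume : Measure (RSpace (j + k))).toSphere =
      (volume : Measure (RSpace k)).toSphere Set.univ *
        ∫⁻ w : RSpace j, ENNReal.ofReal
          (if ‖w‖ < 1 then (1 - ‖w‖ ^ 2) ^ (((k : ℝ) - 2) / 2) else 0) * f w := by
  have := nontrivial_rSpace hj
  have := nontrivial_rSpace hk
  have := nontrivial_rSpace (hj.trans (Nat.le_add_right j k))
  set F : ℝ → ENNReal := (Set.Iio 1).indicator 1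
  have hF : Measurable F := measurable_one.indicator measurableSet_Iio
  set I := ∫⁻ ρ in Set.Ioi (0 : ℝ), ENNReal.ofReal (ρ ^ (j + k - 1)) * F ρ with hI
  have hI0 : I ≠ 0 := by
    rw [hI, lintegral_pow_mul_indicator_Iio_one]
    exact (ENNReal.ofReal_pos.2 (by positivity)).ne'
  have hItop : I ≠ ⊤ := by
    rw [hI, lintegral_pow_mul_indicator_Iio_one]
    exact ENNReal.ofReal_ne_top
  refine (ENNReal.mul_right_inj hI0 hItop).1 ?_
  have hG : Measurable (Function.uncurry fun (ρ : ℝ) (y : RSpace j) => F ρ * f (ρ⁻¹ • y)) :=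
    (hF.comp measurable_fst).mul (hf.comp (by fun_prop))
  have hm1 : ∀ y : RSpace j, Measurable fun z : RSpace k =>
      F √(‖y‖ ^ 2 + ‖z‖ ^ 2) * f ((√(‖y‖ ^ 2 + ‖z‖ ^ 2))⁻¹ • y) := fun y =>
    hG.comp (f := fun z : RSpace k => (√(‖y‖ ^ 2 + ‖z‖ ^ 2), y)) (by fun_prop)
  have hm2 : Measurable fun p : RSpace j × ℝ =>
      F √(‖p.1‖ ^ 2 + p.2 ^ 2) * f ((√(‖p.1‖ ^ 2 + p.2 ^ 2))⁻¹ • p.1) :=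
    hG.comp (f := fun p : RSpace j × ℝ => (√(‖p.1‖ ^ 2 + p.2 ^ 2), p.1)) (by fun_prop)
  have hm3 : Measurable fun y : RSpace j => ∫⁻ s in Set.Ioi (0 : ℝ),
      ENNReal.ofReal (s ^ (k - 1)) *
        (F √(‖y‖ ^ 2 + s ^ 2) * f ((√(‖y‖ ^ 2 + s ^ 2))⁻¹ • y)) :=
    Measurable.lintegral_prod_right' (f := fun p : RSpace j × ℝ => ENNReal.ofReal (p.2 ^ (k - 1)) *
      (F √(‖p.1‖ ^ 2 + p.2 ^ 2) * f ((√(‖p.1‖ ^ 2 + p.2 ^ 2))⁻¹ • p.1)))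
      (Measurable.mul (by fun_prop) hm2)
  calc _ = ∫⁻ x : RSpace (j + k),
          F ‖x‖ * f (‖x‖⁻¹ • coordProj (Nat.le_add_right j k) x) := by
        have h := lintegral_norm_mul_normalize (volume : Measure (RSpace (j + k))) hF
          (f := fun x => f (coordProj (Nat.le_add_right j k) x)) (hf.comp (by fun_prop))
        simp only [map_smul, finrank_euclideanSpace_fin] at h
        exact h.symm
    _ = ∫⁻ y : RSpace j, ∫⁻ z : RSpace k, F √(‖y‖ ^ 2 + ‖z‖ ^ 2) *
          f ((√(‖y‖ ^ 2 + ‖z‖ ^ 2))⁻¹ • y) := lintegral_norm_coordProj j k hG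
    _ = ∫⁻ y : RSpace j, (volume : Measure (RSpace k)).toSphere Set.univ *
          ∫⁻ s in Set.Ioi (0 : ℝ), ENNReal.ofReal (s ^ (k - 1)) *
            (F √(‖y‖ ^ 2 + s ^ 2) * f ((√(‖y‖ ^ 2 + s ^ 2))⁻¹ • y)) := by
        refine lintegral_congr fun y => ?_
        -- The integrand depends on `z` only through `‖z‖`, so the angular integral contributes the
        -- total mass of the sphere.
        rw [lintegral_eq_lintegral_toSphere _ (hm1 y), mul_comm, ← lintegral_const]
        refine lintegral_congr fun θ => ?_
        refine setLIntegral_congr_fun measurableSet_Ioi fun s hs => ?_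
        have hs0 : 0 < s := hs
        have hθ : ‖(θ : RSpace k)‖ = 1 := norm_eq_of_mem_sphere θ
        simp only [norm_smul, hθ, mul_one, Real.norm_of_nonneg hs0.le, finrank_euclideanSpace_fin]
    _ = (volume : Measure (RSpace k)).toSphere Set.univ * ∫⁻ θ : USphere j,
          (I * ∫⁻ τ in Set.Ioo (0 : ℝ) 1, ENNReal.ofReal (τ ^ (j - 1)) *
            (ENNReal.ofReal ((1 - τ ^ 2) ^ (((k : ℝ) - 2) / 2)) * f (τ • (θ : RSpace j))))
          ∂(volume : Measure (RSpace j)).toSphere := by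
        rw [lintegral_const_mul _ hm3, lintegral_eq_lintegral_toSphere _ hm3]
        congr 1
        refine lintegral_congr fun θ => ?_
        have hh : Measurable fun τ : ℝ => f (τ • (θ : RSpace j)) := hf.comp (by fun_prop)
        rw [hI, ← lintegral_Ioi_Ioi_radial hj hk hF hh]
        refine setLIntegral_congr_fun measurableSet_Ioi fun t ht => ?_
        have ht0 : 0 < t := ht
        have hθ : ‖(θ : RSpace j)‖ = 1 := norm_eq_of_mem_sphere θ
        simp only [norm_smul, hθ, mul_one, Real.norm_of_nonneg ht0.le, finrank_euclideanSpace_fin,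
          smul_smul]
        rw [← lintegral_const_mul _ (by fun_prop)]
        simp only [div_eq_inv_mul]
    _ = _ := by
        rw [lintegral_const_mul' _ _ hItop, mul_left_comm]
        congr 2
        have hm : Measurable fun w : RSpace j => ENNReal.ofReal
          (if ‖w‖ < 1 then (1 - ‖w‖ ^ 2) ^ (((k : ℝ) - 2) / 2) else 0) * f w :=
          (ENNReal.measurable_ofReal.comp (Measurable.ite
            (measurableSet_lt (by fun_prop) (by fun_prop)) (by fun_prop) (by fun_prop))).mul hf
        rw [lintegral_eq_lintegral_toSphere _ hm]
        refine lintegral_congr fun θ => ?_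
        have hθ : ‖(θ : RSpace j)‖ = 1 := norm_eq_of_mem_sphere θ
        -- The range `τ < 1` becomes an indicator, matching the support condition `‖w‖ < 1` along
        -- each ray.
        rw [← Set.Ioi_inter_Iio, Set.inter_comm, ← setLIntegral_indicator measurableSet_Iio]
        refine setLIntegral_congr_fun measurableSet_Ioi fun t ht => ?_
        have ht0 : 0 < t := ht
        simp only [norm_smul, hθ, mul_one, Real.norm_of_nonneg ht0.le, finrank_euclideanSpace_fin]
        by_cases h1 : t < 1 <;> simp [h1, Set.indicator]

/-! ### The uniform law on the sphere and its beta marginals -/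

theorem toSphere_univ_eq {m : ℕ} (hm : 1 ≤ m) :
    (volume : Measure (RSpace m)).toSphere Set.univ =
      ENNReal.ofReal (2 * Real.pi ^ ((m : ℝ) / 2) / Real.Gamma ((m : ℝ) / 2)) := by
  have hm' : (0 : ℝ) < m := by exact_mod_cast hm
  have : Nonempty (Fin m) := ⟨⟨0, hm⟩⟩
  rw [Measure.toSphere_apply_univ, EuclideanSpace.volume_ball, Real.Gamma_add_one (by positivity)]
  have := Real.Gamma_pos_of_pos (show (0 : ℝ) < m / 2 by positivity)
  simp only [finrank_euclideanSpace_fin, ENNReal.ofReal_one, one_pow, one_mul, Fintype.card_fin]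
  rw [← ENNReal.ofReal_natCast, ← ENNReal.ofReal_mul (by positivity), Real.sqrt_eq_rpow,
    ← Real.rpow_mul_natCast Real.pi_pos.le]
  congr 1
  rw [show (1 / 2 * (m : ℝ)) = m / 2 by ring]
  field_simp

theorem toSphere_univ_ne_zero {m : ℕ} (hm : 1 ≤ m) :
    (volume : Measure (RSpace m)).toSphere Set.univ ≠ 0 := by
  have := nontrivial_rSpace hm
  exact Measure.measure_univ_ne_zero.2 (Measure.toSphere_ne_zero _)

theorem isProbabilityMeasure_sphereUniform {n : ℕ} (hn : 1 ≤ n) :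
    IsProbabilityMeasure (sphereUniform n) := by
  refine ⟨?_⟩
  rw [sphereUniform, Measure.smul_apply, smul_eq_mul]
  exact ENNReal.inv_mul_cancel (toSphere_univ_ne_zero hn) (measure_ne_top _ _)

/-- The projection of the uniform distribution on the sphere `Sⁿ⁻¹` onto `ℝʲ` is a beta
distribution. -/
theorem map_coordProj_sphereUniform {n j : ℕ} (hj : 1 ≤ j) (hjn : j ≤ n) :
    (sphereUniform n).map (fun u : USphere n => coordProj hjn u) =
      betaDistribution j (((n : ℝ) - (j : ℝ) - 2) / 2) := by
  obtain ⟨k, rfl⟩ := Nat.exists_eq_add_of_le hjn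
  rcases Nat.eq_zero_or_pos k with rfl | hk
  -- Case `j = n`: the parameter is `-1` and the projection is the identity.
  · rw [betaDistribution, if_pos (by push_cast; ring)]
    congr 1
    funext u
    ext i
    exact coordProj_apply _ _ _
  have hk' : (0 : ℝ) < k := by exact_mod_cast hk
  have hj' : (0 : ℝ) < j := by exact_mod_cast hj
  have hβ : (((j + k : ℕ) : ℝ) - j - 2) / 2 = ((k : ℝ) - 2) / 2 := by push_cast; ring
  have hmeas : Measurable fun u : USphere (j + k) => coordProj hjn u :=
    (coordProj hjn).continuous.measurable.comp measurable_subtype_coe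
  rw [hβ, betaDistribution, if_neg (by intro h; linarith)]
  refine Measure.ext_of_lintegral _ fun f hf => ?_
  have hm : Measurable fun w : RSpace j => ENNReal.ofReal (_root_.betaPDF j (((k : ℝ) - 2) / 2) w) := by
    unfold _root_.betaPDF
    exact ENNReal.measurable_ofReal.comp (Measurable.ite
      (measurableSet_lt (by fun_prop) (by fun_prop)) (by fun_prop) (by fun_prop))
  rw [lintegral_map hf hmeas, lintegral_withDensity_eq_lintegral_mul _ hm hf, sphereUniform,
    lintegral_smul_measure, lintegral_toSphere_coordProj hj hk hf, smul_eq_mul, ← mul_assoc,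
    ← lintegral_const_mul' _ _ (ENNReal.mul_ne_top (ENNReal.inv_ne_top.2
      (toSphere_univ_ne_zero (hj.trans hjn))) (measure_ne_top _ _))]
  have hg := Real.Gamma_pos_of_pos (show (0 : ℝ) < k / 2 by positivity)
  have hg' := Real.Gamma_pos_of_pos (show (0 : ℝ) < ((j + k : ℕ) : ℝ) / 2 by positivity)
  -- The beta normalization is the ratio of the surface areas of `Sᵏ⁻¹` and `Sʲ⁺ᵏ⁻¹`.
  have hc : ((volume : Measure (RSpace (j + k))).toSphere Set.univ)⁻¹ *
      (volume : Measure (RSpace k)).toSphere Set.univ =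
      ENNReal.ofReal (betaConst j (((k : ℝ) - 2) / 2)) := by
    rw [toSphere_univ_eq hk, toSphere_univ_eq (hj.trans hjn), ← ENNReal.ofReal_inv_of_pos
      (by positivity), ← ENNReal.ofReal_mul (by positivity), betaConst]
    congr 1
    have e1 : (j : ℝ) / 2 + ((k : ℝ) - 2) / 2 + 1 = ((j + k : ℕ) : ℝ) / 2 := by push_cast; ring
    have e2 : ((k : ℝ) - 2) / 2 + 1 = k / 2 := by ring
    have e3 : Real.pi ^ (((j + k : ℕ) : ℝ) / 2) = Real.pi ^ ((j : ℝ) / 2) * Real.pi ^ ((k : ℝ) / 2) := by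
      rw [← Real.rpow_add Real.pi_pos]
      congr 1
      push_cast
      ring
    rw [e1, e2, e3]
    field_simp
  rw [hc]
  refine lintegral_congr fun w => ?_
  have hb : 0 ≤ betaConst j (((k : ℝ) - 2) / 2) := by
    rw [betaConst]
    have e1 : (j : ℝ) / 2 + ((k : ℝ) - 2) / 2 + 1 = ((j + k : ℕ) : ℝ) / 2 := by push_cast; ring
    have e2 : ((k : ℝ) - 2) / 2 + 1 = k / 2 := by ring
    rw [e1, e2]
    positivity
  rw [← mul_assoc, ← ENNReal.ofReal_mul hb, Pi.mul_apply, _root_.betaPDF, mul_ite, mul_zero]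

theorem map_linearIsometryEquiv_sphereUniform {n : ℕ} (hn : 1 ≤ n)
    (e : RSpace n ≃ₗᵢ[ℝ] RSpace n) :
    (sphereUniform n).map (fun u : USphere n => e u) =
      (sphereUniform n).map (fun u : USphere n => (u : RSpace n)) := by
  have := nontrivial_rSpace hn
  refine Measure.ext_of_lintegral _ fun f hf => ?_
  have he : Measurable fun u : USphere n => e u :=
    e.continuous.measurable.comp measurable_subtype_coe
  rw [lintegral_map hf he,
    lintegral_map hf measurable_subtype_coe, sphereUniform, lintegral_smul_measure,
    lintegral_smul_measure, lintegral_toSphere_comp_linearIsometryEquiv e hf]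

/-! ### Subspaces, shadows and adjoints of isometric embeddings -/

/-- An isometry between two subspaces of equal dimension extends to all of `ℝⁿ`. Surjectivity is
needed to descend measurability from `O(n)` to the Grassmannian. -/
theorem Gr.rotate_surjective {n j : ℕ} (H₀ : Gr n j) :
    Function.Surjective fun u : OGroup n => Gr.rotate u H₀ := by
  intro H
  let e : H₀.1 ≃ₗᵢ[ℝ] H.1 :=
    (stdOrthonormalBasis ℝ H₀.1).repr.trans
    ((stdOrthonormalBasis ℝ H.1).reindex (finCongr (H.2.trans H₀.2.symm))).repr.symm
  let L : H₀.1 →ₗᵢ[ℝ] RSpace n := H.1.subtypeₗᵢ.comp e.toLinearIsometry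
  let E : RSpace n ≃ₗᵢ[ℝ] RSpace n := L.extend.toLinearIsometryEquiv rfl
  refine ⟨Unitary.linearIsometryEquiv.symm E, ?_⟩
  apply Subtype.ext
  refine Submodule.ext fun x => ?_
  constructor
  · rintro ⟨y, hy, rfl⟩
    have : E y = e ⟨y, hy⟩ := L.extend_apply ⟨y, hy⟩
    change E y ∈ H.1
    rw [this]
    exact (e ⟨y, hy⟩).2
  · intro hx
    have : E (e.symm ⟨x, hx⟩) = x := by
      refine (L.extend_apply (e.symm ⟨x, hx⟩)).trans ?_
      simp [L]
    exact ⟨e.symm ⟨x, hx⟩, (e.symm ⟨x, hx⟩).2, this⟩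

/-- For an isometric embedding `T`, the vector `x - T T* x` is orthogonal to the range of `T`,
because `⟪T T* x, T y⟫ = ⟪T* x, y⟫ = ⟪x, T y⟫`. -/
theorem orthogonalProjectionOnto_eq_apply_adjoint {E F : Type*} [NormedAddCommGroup E]
    [InnerProductSpace ℝ E] [CompleteSpace E] [NormedAddCommGroup F] [InnerProductSpace ℝ F]
    [CompleteSpace F] (T : F →ₗᵢ[ℝ] E) {H : Submodule ℝ E} [H.HasOrthogonalProjection]
    (h : LinearMap.range T.toLinearMap = H) (x : E) :
    (H.orthogonalProjectionOnto x : E) =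
      T (ContinuousLinearMap.adjoint T.toContinuousLinearMap x) := by
  refine Submodule.eq_starProjection_of_mem_of_inner_eq_zero ?_ ?_
  · rw [← h]
    exact ⟨_, rfl⟩
  · intro w hw
    rw [← h] at hw
    obtain ⟨y, rfl⟩ := hw
    have h1 := ContinuousLinearMap.adjoint_inner_left T.toContinuousLinearMap y x
    have h2 := T.inner_map_map (ContinuousLinearMap.adjoint T.toContinuousLinearMap x) y
    rw [inner_sub_left, sub_eq_zero]
    exact h1.symm.trans h2.symm

/-- `T` identifies `ℝʲ` with `H` isometrically, hence preserves volume, and turns `T*` into the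
projection onto `H`. -/
theorem volume_symmDiff_shadow {n j : ℕ} (H : Gr n j) (T : RSpace j →ₗᵢ[ℝ] RSpace n)
    (h : LinearMap.range T.toLinearMap = H.1) (K L : Set (RSpace n)) :
    volume (symmDiff (shadow K H) (shadow L H)) =
      volume (symmDiff (ContinuousLinearMap.adjoint T.toContinuousLinearMap '' K)
        (ContinuousLinearMap.adjoint T.toContinuousLinearMap '' L)) := by
  let e : RSpace j ≃ₗᵢ[ℝ] H.1 := T.equivRange.trans (LinearIsometryEquiv.ofEq _ _ h)
  have he : ∀ K : Set (RSpace n),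
      shadow K H = e '' (ContinuousLinearMap.adjoint T.toContinuousLinearMap '' K) := fun K => by
    rw [shadow, Set.image_image]
    refine Set.image_congr fun x _ => Subtype.ext ?_
    rw [orthogonalProjectionOnto_eq_apply_adjoint T h]
    rfl
  rw [he, he, ← Set.image_symmDiff e.injective]
  have := e.symm.measurePreserving.measure_preimage_equiv (f := e.symm.toMeasurableEquiv)
    (symmDiff (ContinuousLinearMap.adjoint T.toContinuousLinearMap '' K)
        (ContinuousLinearMap.adjoint T.toContinuousLinearMap '' L))
  rw [← this]
  congr 1
  exact e.toEquiv.image_eq_preimage_symm _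

/-- `ℝʲ` embedded into `ℝⁿ` as the rotated coordinate subspace. -/
noncomputable def rotatedIncl {n j : ℕ} (hjn : j ≤ n) (u : OGroup n) : RSpace j →ₗᵢ[ℝ] RSpace n :=
  (Unitary.linearIsometryEquiv u).toLinearIsometry.comp (coordIncl hjn)

theorem range_rotatedIncl {n j : ℕ} (hjn : j ≤ n) (u : OGroup n) :
    LinearMap.range (rotatedIncl hjn u).toLinearMap = (Gr.rotate u (Gr.coord hjn)).1 := by
  change _ = (Gr.coord hjn).1.map _
  rw [← range_coordIncl, ← LinearMap.range_comp]
  rfl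

theorem adjoint_rotatedIncl {n j : ℕ} (hjn : j ≤ n) (u : OGroup n) (x : RSpace n) :
    ContinuousLinearMap.adjoint (rotatedIncl hjn u).toContinuousLinearMap x =
      coordProj hjn (star (u : RSpace n →L[ℝ] RSpace n) x) := by
  have : (rotatedIncl hjn u).toContinuousLinearMap =
      (u : RSpace n →L[ℝ] RSpace n) ∘L (coordIncl hjn).toContinuousLinearMap := rfl
  rw [this, ContinuousLinearMap.adjoint_comp]
  rfl

/-- `T*` is a contraction, and `T* T = 1` supplies the preimage `T y` of `y`. -/
theorem image_closedBall_adjoint {E F : Type*} [NormedAddCommGroup E]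
    [InnerProductSpace ℝ E] [CompleteSpace E] [NormedAddCommGroup F] [InnerProductSpace ℝ F]
    [CompleteSpace F] (T : F →ₗᵢ[ℝ] E) (r : ℝ) :
    ContinuousLinearMap.adjoint T.toContinuousLinearMap '' Metric.closedBall 0 r =
      Metric.closedBall 0 r := by
  refine Set.Subset.antisymm ?_ fun y hy => ?_
  · rintro _ ⟨x, hx, rfl⟩
    rw [mem_closedBall_zero_iff] at hx ⊢
    refine le_trans ?_ hx
    have h1 : ‖ContinuousLinearMap.adjoint T.toContinuousLinearMap‖ ≤ 1 := by
      rw [LinearIsometryEquiv.norm_map]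
      exact T.norm_toContinuousLinearMap_le
    simpa using ContinuousLinearMap.le_of_opNorm_le _ h1 x
  · refine ⟨T y, by simpa using hy, ?_⟩
    refine ext_inner_right ℝ fun z => ?_
    rw [ContinuousLinearMap.adjoint_inner_left]
    exact T.inner_map_map y z

/-! ### Measurability and boundedness of the hull functional -/

/-- The volume of the symmetric difference of the convex hull of `N` points and a ball. -/
noncomputable def hullBallVolume {N j : ℕ} (r : ℝ) (x : Fin N → RSpace j) : ℝ :=
  volume.real (symmDiff (convexHull ℝ (Set.range x)) (originBall j r))

theorem volume_real_symmDiff_shadow_rotate {n j N : ℕ} (hjn : j ≤ n) (r : ℝ) (u : OGroup n)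
    (x : Fin N → RSpace n) :
    volume.real (symmDiff (shadow (convexHull ℝ (Set.range x)) (Gr.rotate u (Gr.coord hjn)))
        (shadow (originBall n r) (Gr.rotate u (Gr.coord hjn)))) =
      hullBallVolume r fun i => coordProj hjn (star (u : RSpace n →L[ℝ] RSpace n) (x i)) := by
  rw [Measure.real, volume_symmDiff_shadow _ _ (range_rotatedIncl hjn u), image_closedBall_adjoint,
    hullBallVolume, Measure.real]
  congr 3
  have := (ContinuousLinearMap.adjoint
    (rotatedIncl hjn u).toContinuousLinearMap).toLinearMap.image_convexHull (Set.range x)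
  refine this.trans ?_
  rw [← Set.range_comp]
  congr 2
  funext i
  exact adjoint_rotatedIncl hjn u (x i)

theorem convexHull_range_eq_image_stdSimplex {ι E : Type*} [Fintype ι] [AddCommGroup E]
    [Module ℝ E] (x : ι → E) :
    convexHull ℝ (Set.range x) = (fun w : ι → ℝ => ∑ i, w i • x i) '' stdSimplex ℝ ι := by
  classical
  have h := (Fintype.linearCombination ℝ x).image_convexHull
    (Set.range fun i => (Pi.single i 1 : ι → ℝ))
  rw [← Set.range_comp] at h
  have h2 : (Fintype.linearCombination ℝ x) ∘ (fun i => (Pi.single i 1 : ι → ℝ)) = x := by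
    funext i
    simp [Fintype.linearCombination_apply_single]
  rw [h2] at h
  rw [← h, ← convexHull_rangle_single_eq_stdSimplex]
  rfl

/-- The set is the projection, along the compact simplex of weights, of the closed set of triples
(weights, points, their combination). With no points the simplex and the hull are both empty. -/
theorem isClosed_setOf_mem_convexHull_range {ι E : Type*} [Fintype ι] [NormedAddCommGroup E]
    [NormedSpace ℝ E] :
    IsClosed {p : (ι → E) × E | p.2 ∈ convexHull ℝ (Set.range p.1)} := by
  have : CompactSpace (stdSimplex ℝ ι) := isCompact_iff_compactSpace.1 (isCompact_stdSimplex ℝ ι)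
  have hcl : IsClosed {q : stdSimplex ℝ ι × ((ι → E) × E) |
      ∑ i, (q.1 : ι → ℝ) i • q.2.1 i = q.2.2} :=
    isClosed_eq (continuous_finsetSum _ fun i _ => Continuous.smul
      ((continuous_apply i).comp (continuous_subtype_val.comp continuous_fst)) (by fun_prop))
      (by fun_prop)
  convert isClosedMap_snd_of_compactSpace _ hcl using 1
  ext p
  simp only [Set.mem_ofPred_eq, convexHull_range_eq_image_stdSimplex, Set.mem_image, Prod.exists]
  constructor
  · rintro ⟨w, hw, h⟩
    exact ⟨⟨w, hw⟩, p.1, p.2, h, rfl⟩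
  · rintro ⟨w, a, b, h, rfl⟩
    exact ⟨w, w.2, h⟩

theorem measurable_hullBallVolume {N j : ℕ} (r : ℝ) :
    Measurable (hullBallVolume r : (Fin N → RSpace j) → ℝ) := by
  have hC : MeasurableSet {p : (Fin N → RSpace j) × RSpace j |
      p.2 ∈ convexHull ℝ (Set.range p.1)} := isClosed_setOf_mem_convexHull_range.measurableSet
  have hB : MeasurableSet {p : (Fin N → RSpace j) × RSpace j | p.2 ∈ originBall j r} :=
    measurable_snd Metric.isClosed_closedBall.measurableSet
  exact (measurable_measure_prodMk_left (ν := (volume : Measure (RSpace j)))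
    (hC.symmDiff hB)).ennreal_toReal

theorem hullBallVolume_nonneg {N j : ℕ} (r : ℝ) (x : Fin N → RSpace j) :
    0 ≤ hullBallVolume r x := measureReal_nonneg

theorem hullBallVolume_le {N j : ℕ} (r : ℝ) {x : Fin N → RSpace j} (hx : ∀ i, ‖x i‖ ≤ 1) :
    hullBallVolume r x ≤ volume.real (originBall j (max 1 r)) := by
  refine measureReal_mono ?_ Metric.isBounded_closedBall.measure_lt_top.ne
  refine Set.symmDiff_subset_union.trans (Set.union_subset ?_ ?_)
  · refine convexHull_min ?_ (convex_closedBall _ _)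
    rintro _ ⟨i, rfl⟩
    simpa using Or.inl (hx i)
  · exact Metric.closedBall_subset_closedBall (le_max_right _ _)

/-! ### Projected random points and their joint law -/

/-- The projections of `N` points of the sphere to the rotated coordinate subspace. -/
noncomputable def rotatedProj {n j : ℕ} (hjn : j ≤ n) {N : ℕ} (u : OGroup n)
    (x : Fin N → USphere n) (i : Fin N) : RSpace j :=
  coordProj hjn (star (u : RSpace n →L[ℝ] RSpace n) (x i))

theorem norm_rotatedProj_le {n j : ℕ} (hjn : j ≤ n) {N : ℕ} (u : OGroup n)
    (x : Fin N → USphere n) (i : Fin N) : ‖rotatedProj hjn u x i‖ ≤ 1 := by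
  have h1 : ‖coordProj hjn‖ ≤ 1 := by
    rw [coordProj, LinearIsometryEquiv.norm_map]
    exact (coordIncl hjn).norm_toContinuousLinearMap_le
  have h2 : ‖star (u : RSpace n →L[ℝ] RSpace n) (x i)‖ = 1 :=
    (Unitary.norm_map (star u) _).trans (norm_eq_of_mem_sphere (x i))
  have := ContinuousLinearMap.le_of_opNorm_le _ h1 (star (u : RSpace n →L[ℝ] RSpace n) (x i))
  rwa [h2, mul_one] at this

theorem continuous_rotatedProj {n j : ℕ} (hjn : j ≤ n) {N : ℕ} :
    Continuous fun p : OGroup n × (Fin N → USphere n) => rotatedProj hjn p.1 p.2 := by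
  refine continuous_pi fun i => (coordProj hjn).continuous.comp ?_
  exact Continuous.clm_apply (by fun_prop) (by fun_prop)

/-- Rotation invariance of the uniform law absorbs `u*`, leaving the coordinate projection;
independence of the points is preserved because the map acts pointwise. The result does not involve
`u`. -/
theorem map_rotatedProj {n j : ℕ} (hj : 1 ≤ j) (hjn : j ≤ n) (N : ℕ) (u : OGroup n) :
    (Measure.pi fun _ : Fin N => sphereUniform n).map (rotatedProj hjn u) =
      Measure.pi fun _ : Fin N => betaDistribution j (((n : ℝ) - (j : ℝ) - 2) / 2) := by
  have := isProbabilityMeasure_sphereUniform (hj.trans hjn)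
  have hm : Measurable fun x : USphere n =>
      coordProj hjn (star (u : RSpace n →L[ℝ] RSpace n) x) := by fun_prop
  have hlaw : (sphereUniform n).map (fun x : USphere n =>
      coordProj hjn (star (u : RSpace n →L[ℝ] RSpace n) x)) =
      betaDistribution j (((n : ℝ) - (j : ℝ) - 2) / 2) := by
    have he : Measurable fun x : USphere n => Unitary.linearIsometryEquiv (star u) (x : RSpace n) :=
      (Unitary.linearIsometryEquiv (star u)).continuous.measurable.comp measurable_subtype_coe
    rw [← map_coordProj_sphereUniform hj hjn]
    have h1 := Measure.map_map (μ := sphereUniform n) (coordProj hjn).continuous.measurable he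
    have h2 := Measure.map_map (μ := sphereUniform n) (coordProj hjn).continuous.measurable
      measurable_subtype_coe
    rw [map_linearIsometryEquiv_sphereUniform (hj.trans hjn)] at h1
    exact h1.symm.trans h2
  have hp : IsProbabilityMeasure (betaDistribution j (((n : ℝ) - (j : ℝ) - 2) / 2)) :=
    hlaw ▸ Measure.isProbabilityMeasure_map hm.aemeasurable
  rw [← hlaw]
  have : IsProbabilityMeasure ((sphereUniform n).map (fun x : USphere n =>
      coordProj hjn (star (u : RSpace n →L[ℝ] RSpace n) x))) := hlaw ▸ hp
  exact Measure.pi_map_pi (μ := fun _ : Fin N => sphereUniform n) fun _ => hm.aemeasurable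

theorem volume_real_symmDiff_shadow_eq_rotatedProj {n j N : ℕ} (hjn : j ≤ n) (r : ℝ)
    (u : OGroup n) (x : Fin N → USphere n) :
    volume.real (symmDiff
        (shadow (convexHull ℝ (Set.range fun i => (x i : RSpace n))) (Gr.rotate u (Gr.coord hjn)))
        (shadow (originBall n r) (Gr.rotate u (Gr.coord hjn)))) =
      hullBallVolume r (rotatedProj hjn u x) :=
  volume_real_symmDiff_shadow_rotate hjn r u _

attribute [irreducible] rotatedProj hullBallVolume

/-! ### Integrability and exchange of expectations -/

instance OGroup.secondCountableTopology (n : ℕ) : SecondCountableTopology (OGroup n) := by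
  have : ProperSpace (RSpace n →L[ℝ] RSpace n) := FiniteDimensional.proper ℝ _
  infer_instance

instance Gr.t0Space (n j : ℕ) : T0Space (Gr n j) := by
  have h : Topology.IsEmbedding (fun H : Gr n j => H.1.starProjection) :=
    ⟨⟨rfl⟩, fun H K h => Subtype.ext (Submodule.starProjection_inj.1 h)⟩
  exact h.t0Space

instance Gr.secondCountableTopology (n j : ℕ) : SecondCountableTopology (Gr n j) := by
  have : ProperSpace (RSpace n →L[ℝ] RSpace n) := FiniteDimensional.proper ℝ _
  exact TopologicalSpace.secondCountableTopology_induced _ _ _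

theorem measurable_rotatedProj {n j : ℕ} (hjn : j ≤ n) {N : ℕ} :
    Measurable fun p : OGroup n × (Fin N → USphere n) => rotatedProj hjn p.1 p.2 :=
  (continuous_rotatedProj hjn).measurable

theorem measurable_rotatedProj_right {n j : ℕ} (hjn : j ≤ n) {N : ℕ} (u : OGroup n) :
    Measurable (rotatedProj hjn u : (Fin N → USphere n) → Fin N → RSpace j) := by
  have hu : Measurable fun x : Fin N → USphere n => (u, x) := measurable_prodMk_left
  exact (measurable_rotatedProj hjn).comp hu

theorem measurable_hullBallVolume_rotatedProj {n j : ℕ} (hjn : j ≤ n) {N : ℕ} (r : ℝ) :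
    Measurable fun p : OGroup n × (Fin N → USphere n) =>
      hullBallVolume r (rotatedProj hjn p.1 p.2) := by
  have h := measurable_rotatedProj hjn (N := N)
  exact (measurable_hullBallVolume r).comp h

theorem integrable_hullBallVolume_rotatedProj {n j : ℕ} (hjn : j ≤ n) {N : ℕ} (r : ℝ)
    (μ : Measure (Fin N → USphere n)) [IsFiniteMeasure μ] :
    Integrable (fun p : (Fin N → USphere n) × OGroup n =>
      hullBallVolume r (rotatedProj hjn p.2 p.1)) (μ.prod (orthogonalHaar n)) := by
  have hs : Measurable fun p : (Fin N → USphere n) × OGroup n => (p.2, p.1) := measurable_swap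
  have hm := (measurable_hullBallVolume_rotatedProj hjn r).comp hs
  refine Integrable.of_bound hm.aestronglyMeasurable (volume.real (originBall j (max 1 r)))
    (.of_forall fun p => ?_)
  rw [Real.norm_of_nonneg (hullBallVolume_nonneg _ _)]
  exact hullBallVolume_le r (norm_rotatedProj_le hjn p.2 p.1)

theorem intrinsicVolumeMetric_convexHull {n j : ℕ} (hjn : j ≤ n) {N : ℕ} (r : ℝ)
    (x : Fin N → USphere n) :
    intrinsicVolumeMetric hjn (convexHull ℝ (Set.range fun i => (x i : RSpace n)))
        (originBall n r) =
      flagCoeff n j * ∫ u, hullBallVolume r (rotatedProj hjn u x) ∂(orthogonalHaar n) := by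
  rw [intrinsicVolumeMetric, grassmannianHaar]
  congr 1
  have hrot : Measurable fun u : OGroup n => Gr.rotate u (Gr.coord hjn) :=
    (Gr.continuous_rotate _).measurable
  have hcomp : ∀ u : OGroup n, volume.real (symmDiff
      (shadow (convexHull ℝ (Set.range fun i => (x i : RSpace n))) (Gr.rotate u (Gr.coord hjn)))
      (shadow (originBall n r) (Gr.rotate u (Gr.coord hjn)))) =
      hullBallVolume r (rotatedProj hjn u x) := fun u =>
    volume_real_symmDiff_shadow_eq_rotatedProj hjn r u x
  have hmeas : Measurable fun H : Gr n j => volume.real (symmDiff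
      (shadow (convexHull ℝ (Set.range fun i => (x i : RSpace n))) H)
      (shadow (originBall n r) H)) := by
    -- `O(n)` is standard Borel and `Gr(n,j)` is countably separated, being second countable and T0.
    -- A function on `Gr(n,j)` is therefore measurable once its pullback along the surjective orbit
    -- map is.
    refine (hrot.measurable_comp_iff_of_surjective (Gr.rotate_surjective _)).1 ?_
    have hx : Measurable fun u : OGroup n => (u, x) := measurable_prodMk_right
    have h := (measurable_hullBallVolume_rotatedProj hjn r).comp hx
    refine Eq.mpr (congrArg Measurable (funext fun u => ?_)) h
    exact hcomp u
  rw [integral_map hrot.aemeasurable hmeas.aestronglyMeasurable]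
  exact integral_congr_ae (.of_forall hcomp)

/-- The product beta law is the image of the product sphere law under `rotatedProj hjn 1`, whose
values lie in the unit ball; the functional is therefore bounded almost surely, uniformly over all
admissible `j`, including `β = -1`. -/
theorem integrable_hullBallVolume_pi_beta {n j : ℕ} (hj : 1 ≤ j) (hjn : j ≤ n) (N : ℕ) (r : ℝ) :
    Integrable (hullBallVolume r)
      (Measure.pi fun _ : Fin N => betaDistribution j (((n : ℝ) - (j : ℝ) - 2) / 2)) := by
  have := isProbabilityMeasure_sphereUniform (hj.trans hjn)
  have hm : Measurable (rotatedProj hjn (1 : OGroup n) : (Fin N → USphere n) → Fin N → RSpace j) :=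
    measurable_rotatedProj_right hjn 1
  have hg : Measurable (hullBallVolume r : (Fin N → RSpace j) → ℝ) := measurable_hullBallVolume r
  rw [← map_rotatedProj hj hjn N 1, integrable_map_measure hg.aestronglyMeasurable hm.aemeasurable]
  refine Integrable.of_bound (hg.comp hm).aestronglyMeasurable
    (volume.real (originBall j (max 1 r))) (.of_forall fun x => ?_)
  rw [Function.comp_apply, Real.norm_of_nonneg (hullBallVolume_nonneg _ _)]
  exact hullBallVolume_le r (norm_rotatedProj_le hjn 1 x)

/-- After Fubini the inner integral over the points is the same for every `u`, and the Haar measure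
has total mass one. -/
theorem integral_integral_hullBallVolume_rotatedProj {n j : ℕ} (hj : 1 ≤ j) (hjn : j ≤ n) (N : ℕ)
    (r : ℝ) :
    ∫ x, ∫ u, hullBallVolume r (rotatedProj hjn u x) ∂(orthogonalHaar n)
        ∂(Measure.pi fun _ : Fin N => sphereUniform n) =
      ∫ y, hullBallVolume r y
        ∂(Measure.pi fun _ : Fin N => betaDistribution j (((n : ℝ) - (j : ℝ) - 2) / 2)) := by
  have := isProbabilityMeasure_sphereUniform (hj.trans hjn)
  rw [integral_integral_swap (integrable_hullBallVolume_rotatedProj hjn r _)]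
  have h : ∀ u : OGroup n, ∫ x, hullBallVolume r (rotatedProj hjn u x)
      ∂(Measure.pi fun _ : Fin N => sphereUniform n) = ∫ y, hullBallVolume r y
        ∂(Measure.pi fun _ : Fin N => betaDistribution j (((n : ℝ) - (j : ℝ) - 2) / 2)) := fun u => by
    rw [← map_rotatedProj hj hjn N u, integral_map
      (measurable_rotatedProj_right hjn u).aemeasurable
      (measurable_hullBallVolume r).aestronglyMeasurable]
  simp only [h, integral_const, probReal_univ, one_smul]

theorem lemma4p1 {n j : ℕ} (hj : 1 ≤ j) (hjn : j ≤ n) (N : ℕ) (r : ℝ) (hr : 0 < r)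
    {Ω : Type*} [MeasurableSpace Ω] (P : Measure Ω) [IsProbabilityMeasure P]
    {Ω' : Type*} [MeasurableSpace Ω'] (P' : Measure Ω') [IsProbabilityMeasure P']
    (U : Fin N → Ω → USphere n)
    (hU_law : ∀ i, HasLaw (U i) (sphereUniform n) P) (hU_indep : iIndepFun U P)
    (X : Fin N → Ω' → RSpace j)
    (hX_law : ∀ i, HasLaw (X i) (betaDistribution j (((n : ℝ) - (j : ℝ) - 2) / 2)) P')
    (hX_indep : iIndepFun X P') :
    Integrable (fun ω => intrinsicVolumeMetric hjn
      (convexHull ℝ (Set.range fun i => (U i ω : RSpace n))) (originBall n r)) P ∧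
    Integrable (fun ω => volume.real
      (symmDiff (convexHull ℝ (Set.range fun i => X i ω)) (originBall j r))) P' ∧
    ∫ ω, intrinsicVolumeMetric hjn
        (convexHull ℝ (Set.range fun i => (U i ω : RSpace n))) (originBall n r) ∂P =
      flagCoeff n j *
        ∫ ω, volume.real
          (symmDiff (convexHull ℝ (Set.range fun i => X i ω)) (originBall j r)) ∂P' := by
  have := isProbabilityMeasure_sphereUniform (hj.trans hjn)
  have hU := hU_indep.hasLaw_pi hU_law
  have hX := hX_indep.hasLaw_pi hX_law
  have hprod := integrable_hullBallVolume_rotatedProj hjn r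
    (Measure.pi fun _ : Fin N => sphereUniform n)
  have hgβ := integrable_hullBallVolume_pi_beta hj hjn N r
  have hδ := hprod.integral_prod_left
  have hUδ : (fun ω => intrinsicVolumeMetric hjn
      (convexHull ℝ (Set.range fun i => (U i ω : RSpace n))) (originBall n r)) = fun ω =>
      flagCoeff n j * ∫ u, hullBallVolume r (rotatedProj hjn u fun i => U i ω)
        ∂(orthogonalHaar n) :=
    funext fun ω => intrinsicVolumeMetric_convexHull hjn r fun i => U i ω
  have hXv : (fun ω => volume.real (symmDiff (convexHull ℝ (Set.range fun i => X i ω))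
      (originBall j r))) = fun ω => hullBallVolume r fun i => X i ω := by
    simp only [hullBallVolume]
  rw [hUδ, hXv]
  refine ⟨?_, ?_, ?_⟩
  · rw [← hU.map_eq] at hδ
    exact (hδ.comp_aemeasurable hU.aemeasurable).const_mul _
  · rw [← hX.map_eq] at hgβ
    exact hgβ.comp_aemeasurable hX.aemeasurable
  · rw [integral_const_mul]
    congr 1
    have h1 := hU.integral_comp hδ.aestronglyMeasurable
    have h2 := hX.integral_comp hgβ.aestronglyMeasurable
    exact (h1.trans (integral_integral_hullBallVolume_rotatedProj hj hjn N r)).trans h2.symm
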